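/- Theorem 1. For each $n$ consider the linear model $\bm Y_n=\bm X_n\bm\beta_n^0+\bm\varepsilon_n$ with a deterministic $n\times p_n$ design matrix $\bm X_n$, $p_n\ge 1$, and true coefficient vector $\bm\beta_n^0\in\mathbb R^{p_n}$, and let $q_n=|\{j:\beta^0_{nj}\ne 0\}|$. Let $d_1\ge\dots\ge d_{p_n}$ be the eigenvalues of $\bm X_n^T\bm X_n/n$ (they depend on $n$). Assume: (A1) for each $n$, the components of $\bm\varepsilon_n$ are i.i.d. with mean $0$ and variance $\sigma^2\in(0,\infty)$, where $\sigma^2$ does not depend on $n$; (A2) $0<d_{\min}<\liminf_{n\to\infty} d_{p_n}\le\limsup_{n\to\infty} d_1<d_{\max}<\infty$ for some constants $d_{\min},d_{\max}$; (A3) $\limsup_{n\to\infty}\max_{1\le j\le p_n}|\beta^0_{nj}|<\infty$. Let $p_n=o(n)$ and let $q_n=o\{n^{1-\rho}/(p_n(\log n)^2)\}$ for some $\rho\in(0,1)$. Let $C>0$ be a finite constant and let $\gamma_n$ be such that $\sqrt{\sigma^2/\gamma_n}=C/(\sqrt{p_n}\,n^{\rho/2}\log n)$ for all sufficiently large $n$.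 Consider the posterior distribution $\Pi_n(\cdot\mid\bm Y_n)$ given by Bayes' formula from the conjugate normal prior $\bm\beta_n\sim N(0,(\sigma^2/\gamma_n)\bm I_{p_n})$ and the Gaussian likelihood $\bm Y_n\mid\bm\beta_n\sim N(\bm X_n\bm\beta_n,\sigma^2\bm I_n)$ (the true errors need not be Gaussian). Then the posterior is consistent: for every $\epsilon>0$, $$\Pi_n\left(\{\bm\beta_n\in\mathbb R^{p_n}:\|\bm\beta_n-\bm\beta_n^0\|>\epsilon\}\mid\bm Y_n\right)\to 0\quad\text{in probability as }n\to\infty,$$ where $\|\cdot\|$ is the Euclidean norm. -/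

import Mathlib

open MeasureTheory ProbabilityTheory Filter Asymptotics
open scoped NNReal ENNReal Topology Matrix

/-- The scaled Gram matrix `XᵀX / n` of an `n × p` design matrix. -/
noncomputable def scaledGram {n p : ℕ} (X : Matrix (Fin n) (Fin p) ℝ) :
    Matrix (Fin p) (Fin p) ℝ :=
  (n : ℝ)⁻¹ • (Xᵀ * X)

theorem scaledGram_isHermitian {n p : ℕ} (X : Matrix (Fin n) (Fin p) ℝ) :
    (scaledGram X).IsHermitian := by
  unfold scaledGram Matrix.IsHermitian
  rw [Matrix.conjTranspose_eq_transpose_of_trivial, Matrix.transpose_smul,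
    Matrix.transpose_mul, Matrix.transpose_transpose]

/-- The largest eigenvalue `d₁` of `XᵀX / n`, as an extended real. -/
noncomputable def maxEigenvalue {n p : ℕ} (X : Matrix (Fin n) (Fin p) ℝ) : EReal :=
  ⨆ j, (((scaledGram_isHermitian X).eigenvalues j : ℝ) : EReal)

/-- The smallest eigenvalue `d_p` of `XᵀX / n`, as an extended real. -/
noncomputable def minEigenvalue {n p : ℕ} (X : Matrix (Fin n) (Fin p) ℝ) : EReal :=
  ⨅ j, (((scaledGram_isHermitian X).eigenvalues j : ℝ) : EReal)

/-- The linear model `Y = X β + ε`. -/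
noncomputable def response {n p : ℕ} (X : Matrix (Fin n) (Fin p) ℝ)
    (β : EuclideanSpace ℝ (Fin p)) (e : Fin n → ℝ) : Fin n → ℝ :=
  (X *ᵥ β.ofLp) + e

/-- The normal distribution `N(0, v I_p)` on `ℝ^p`: independent `N(0, v)` coordinates. -/
noncomputable def normalPrior (p : ℕ) (v : ℝ≥0) : Measure (EuclideanSpace ℝ (Fin p)) :=
  (Measure.pi fun _ : Fin p => gaussianReal 0 v).map (WithLp.toLp 2)

instance normalPrior_isProbabilityMeasure (p : ℕ) (v : ℝ≥0) :
    IsProbabilityMeasure (normalPrior p v) :=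
  Measure.isProbabilityMeasure_map (by fun_prop)

/-- The Gaussian likelihood of `β`: the density of `N(X β, v I_n)` at the data `y`. -/
noncomputable def gaussianLikelihood {n p : ℕ} (X : Matrix (Fin n) (Fin p) ℝ) (v : ℝ≥0)
    (y : Fin n → ℝ) (β : EuclideanSpace ℝ (Fin p)) : ℝ≥0∞ :=
  ∏ i, gaussianPDF ((X *ᵥ β.ofLp) i) v (y i)

/-- Bayes' formula: the posterior distribution of a parameter with prior `Π` and likelihood `L`,
i.e. `A ↦ (∫_A L dΠ) / (∫ L dΠ)`. -/
noncomputable def bayesPosterior {E : Type*} [MeasurableSpace E] (prior : Measure E)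
    (L : E → ℝ≥0∞) : Measure E :=
  (∫⁻ β, L β ∂prior)⁻¹ • prior.withDensity L

/-- The posterior of `β` given `Y = y` in the model `Y | β ∼ N(X β, v I_n)`, `β ∼ N(0, w I_p)`. -/
noncomputable def normalPosterior {n p : ℕ} (X : Matrix (Fin n) (Fin p) ℝ) (v w : ℝ≥0)
    (y : Fin n → ℝ) : Measure (EuclideanSpace ℝ (Fin p)) :=
  bayesPosterior (normalPrior p w) (gaussianLikelihood X v y)

/-- The posterior above is a genuine probability measure for every data vector `y`. -/
theorem normalPosterior_isProbabilityMeasure {n p : ℕ} (X : Matrix (Fin n) (Fin p) ℝ)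
    {v : ℝ≥0} (hv : v ≠ 0) (w : ℝ≥0) (y : Fin n → ℝ) :
    IsProbabilityMeasure (normalPosterior X v w y) := by
  have hm : Measurable (gaussianLikelihood X v y) := by
    unfold gaussianLikelihood gaussianPDF gaussianPDFReal Matrix.mulVec dotProduct
    fun_prop
  have hpos : ∀ β, gaussianLikelihood X v y β ≠ 0 := fun β =>
    Finset.prod_ne_zero_iff.2 fun i _ => (gaussianPDF_pos _ hv _).ne'
  have h0 : ∫⁻ β, gaussianLikelihood X v y β ∂(normalPrior p w) ≠ 0 := by
    intro h
    rw [lintegral_eq_zero_iff hm] at h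
    obtain ⟨β, hβ⟩ := h.exists
    exact hpos β hβ
  have hle : ∀ β, gaussianLikelihood X v y β ≤
      ∏ _i : Fin n, ENNReal.ofReal ((√(2 * Real.pi * v))⁻¹) := by
    intro β
    refine Finset.prod_le_prod' fun i _ => ENNReal.ofReal_le_ofReal ?_
    refine mul_le_of_le_one_right (by positivity) (Real.exp_le_one_iff.2 ?_)
    rw [neg_div]
    exact neg_nonpos.2 (by positivity)
  have htop : ∫⁻ β, gaussianLikelihood X v y β ∂(normalPrior p w) ≠ ∞ := by
    refine ((lintegral_mono hle).trans_lt ?_).ne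
    rw [lintegral_const, measure_univ, mul_one]
    exact ENNReal.prod_lt_top fun _ _ => ENNReal.ofReal_lt_top
  refine ⟨?_⟩
  simp only [normalPosterior, bayesPosterior, Measure.smul_apply, smul_eq_mul,
    withDensity_apply _ MeasurableSet.univ, Measure.restrict_univ]
  exact ENNReal.inv_mul_cancel h0 htop

/-- Posterior consistency: for every `η > 0` the (random) posterior probability of
`{β : ‖β - βₙ⁰‖ > η}` converges to `0` in probability as `n → ∞`. -/
def PosteriorConsistent {Ω : Type*} [MeasurableSpace Ω] (μ : Measure Ω) {p : ℕ → ℕ}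
    (post : (n : ℕ) → Ω → Measure (EuclideanSpace ℝ (Fin (p n))))
    (β₀ : (n : ℕ) → EuclideanSpace ℝ (Fin (p n))) : Prop :=
  ∀ η : ℝ, 0 < η →
    TendstoInMeasure μ (fun n ω => (post n ω).real {β | η < ‖β - β₀ n‖}) atTop (fun _ => 0)

/-- The number of nonzero coordinates of `β`. -/
noncomputable def numNonzero {p : ℕ} (β : EuclideanSpace ℝ (Fin p)) : ℕ :=
  {j | β j ≠ 0}.ncard

/-! Given the data, the posterior is Gaussian, centred at the ridge estimator `m` with penalty `γ`,
and its precision is at least `n * dmin / σ ^ 2`. A Chernoff bound (`normalPosterior_le`) gives mass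
at most `√2 ^ p * exp (-c n)` far from `m`, negligible because `p = o(n)`. It remains to see that
`m` is close to the truth (`ridge_error_le`). The noise term is `‖Xᵀ ε‖ / (n * dmin)`, and `E ‖Xᵀ ε‖
^ 2 = σ ^ 2 ∑ X i j ^ 2 ≤ σ ^ 2 n p dmax`, so Chebyshev bounds it with failure probability of order
`p / n`. Only second moments of the errors enter. The squared shrinkage bias is at most `γ ‖β₀‖ ^ 2
/ (n * dmin)`; with at most `q` bounded nonzero coordinates and `γ` of order `p n ^ ρ (log n) ^ 2`,
it vanishes by the growth condition on `q`. -/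

theorem prod_gaussianPDF_eq {n : ℕ} (a y : Fin n → ℝ) (v : ℝ≥0) :
    ∏ i, gaussianPDF (a i) v (y i) =
      ENNReal.ofReal ((√(2 * Real.pi * v))⁻¹ ^ n * Real.exp (-(∑ i, (y i - a i) ^ 2) / (2 * v))) := by
  simp only [gaussianPDF, gaussianPDFReal]
  rw [← ENNReal.ofReal_prod_of_nonneg fun i _ => by positivity, Finset.prod_mul_distrib,
    Finset.prod_const, Finset.card_univ, Fintype.card_fin, ← Real.exp_sum, ← Finset.sum_div,
    Finset.sum_neg_distrib]

/-- By uniqueness of the product measure it suffices to test boxes, where Fubini for products of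
real functions factors the integral. -/
theorem pi_withDensity_ofReal {p : ℕ} {f : ℝ → ℝ} (hf : Integrable f)
    (h0 : ∀ x, 0 ≤ f x) :
    Measure.pi (fun _ : Fin p => (volume : Measure ℝ).withDensity fun x => ENNReal.ofReal (f x)) =
      (volume : Measure (Fin p → ℝ)).withDensity fun x => ∏ j, ENNReal.ofReal (f (x j)) := by
  have : IsFiniteMeasure ((volume : Measure ℝ).withDensity fun x => ENNReal.ofReal (f x)) :=
    isFiniteMeasure_withDensity_ofReal hf.2
  refine Measure.pi_eq fun s hs => ?_
  rw [withDensity_apply _ (MeasurableSet.univ_pi hs), volume_pi, Measure.restrict_pi_pi]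
  have hi : ∀ j, Integrable f ((volume : Measure ℝ).restrict (s j)) := fun j => hf.integrableOn
  calc _ = ∫⁻ x, ENNReal.ofReal (∏ j, f (x j))
        ∂(Measure.pi fun j => (volume : Measure ℝ).restrict (s j)) := by
        simp_rw [ENNReal.ofReal_prod_of_nonneg fun j _ => h0 _]
    _ = ENNReal.ofReal (∫ x, ∏ j, f (x j)
        ∂(Measure.pi fun j => (volume : Measure ℝ).restrict (s j))) := by
        rw [ofReal_integral_eq_lintegral_ofReal]
        · exact Integrable.fintype_prod hi
        · exact ae_of_all _ fun x => Finset.prod_nonneg fun j _ => h0 _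
    _ = _ := by
        rw [integral_fintype_prod_eq_prod (fun _ => f),
          ENNReal.ofReal_prod_of_nonneg fun j _ => integral_nonneg h0]
        refine Finset.prod_congr rfl fun j _ => ?_
        rw [withDensity_apply _ (hs j), ofReal_integral_eq_lintegral_ofReal (hi j) (ae_of_all _ h0)]

/-- A Lebesgue density for the prior makes translation and scaling available for the posterior. -/
theorem normalPrior_eq_withDensity (p : ℕ) {v : ℝ≥0} (hv : v ≠ 0) :
    normalPrior p v = volume.withDensity fun β => ∏ j, gaussianPDF 0 v (β j) := by
  have hg : Measurable fun x : Fin p → ℝ => ∏ j, gaussianPDF 0 v (x j) :=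
    Finset.measurable_prod _ fun j _ => (measurable_gaussianPDF 0 v).comp (measurable_pi_apply j)
  have hpi : Measure.pi (fun _ : Fin p => gaussianReal 0 v) =
      (volume : Measure (Fin p → ℝ)).withDensity fun x => ∏ j, gaussianPDF 0 v (x j) := by
    rw [gaussianReal_of_var_ne_zero 0 hv]
    exact pi_withDensity_ofReal (integrable_gaussianPDFReal 0 v)
      (gaussianPDFReal_nonneg 0 v)
  have hvp := PiLp.volume_preserving_toLp (Fin p)
  rw [normalPrior, hpi]
  ext s hs
  rw [Measure.map_apply (by fun_prop) hs, withDensity_apply _ (hs.preimage (by fun_prop)),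
    withDensity_apply _ hs]
  exact hvp.setLIntegral_comp_preimage hs (hg.comp (WithLp.measurable_ofLp 2 _))

/-! ### Chernoff bound for Gaussian-type posteriors -/

section GaussianConcentration

variable {E : Type*} [NormedAddCommGroup E] [NormedSpace ℝ E] [FiniteDimensional ℝ E]
  [MeasurableSpace E] [BorelSpace E] (μ : Measure E) [μ.IsAddHaarMeasure]

/-- Scaling of a Gaussian integral: halving the exponent multiplies the integral by `√2 ^ dim`. -/
theorem lintegral_exp_neg_quarter {Q : E → ℝ} (hQ : Measurable Q)
    (hom : ∀ (t : ℝ) x, Q (t • x) = t ^ 2 * Q x) :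
    ∫⁻ x, ENNReal.ofReal (Real.exp (-Q x / 4)) ∂μ =
      ENNReal.ofReal (√2 ^ Module.finrank ℝ E) * ∫⁻ x, ENNReal.ofReal (Real.exp (-Q x / 2)) ∂μ := by
  -- Substitute `x ↦ x / √2`, which halves the quadratic form.
  have h2 : (√2)⁻¹ ≠ (0 : ℝ) := by positivity
  have hmap := Measure.map_addHaar_smul μ h2
  have hm : Measurable fun x => ENNReal.ofReal (Real.exp (-Q x / 2)) := by fun_prop
  have key := lintegral_map (μ := μ) hm (measurable_const_smul (M := ℝ) (α := E) (√2)⁻¹)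
  rw [hmap, lintegral_smul_measure] at key
  rw [abs_of_pos (by positivity), inv_pow, inv_inv, smul_eq_mul] at key
  rw [key]
  refine lintegral_congr fun x => ?_
  rw [hom, inv_pow, Real.sq_sqrt (by norm_num)]
  congr 2
  ring

/-- Split `exp (-Q / 2)` into two factors `exp (-Q / 4)`: one is small on the tail set, the other
integrates to `√2 ^ dim` times the normaliser. The constant `K` cancels. -/
theorem bayesPosterior_withDensity_le {g L : E → ℝ≥0∞} (hg : Measurable g) (hL : Measurable L)
    {Q : E → ℝ} (hQ : Measurable Q) (hom : ∀ (t : ℝ) x, Q (t • x) = t ^ 2 * Q x)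
    {c : ℝ} (hc : ∀ x, c * ‖x‖ ^ 2 ≤ Q x) (hc0 : 0 ≤ c) (m : E) {K : ℝ≥0∞}
    (hK : ∀ x, g x * L x = K * ENNReal.ofReal (Real.exp (-Q (x - m) / 2))) {η : ℝ} (hη : 0 ≤ η) :
    bayesPosterior (μ.withDensity g) L {x | η ≤ ‖x - m‖} ≤
      ENNReal.ofReal (√2 ^ Module.finrank ℝ E * Real.exp (-(c * η ^ 2 / 4))) := by
  have hA : MeasurableSet {x : E | η ≤ ‖x - m‖} :=
    measurableSet_le measurable_const (by fun_prop)
  have hQm : Measurable fun x => Q (x - m) := hQ.comp (measurable_sub_const m)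
  set b := ENNReal.ofReal (√2 ^ Module.finrank ℝ E * Real.exp (-(c * η ^ 2 / 4))) with hb
  have hZ : ∫⁻ x, L x ∂(μ.withDensity g) =
      K * ∫⁻ x, ENNReal.ofReal (Real.exp (-Q x / 2)) ∂μ := by
    rw [lintegral_withDensity_eq_lintegral_mul _ hg hL]
    simp only [Pi.mul_apply, hK]
    rw [lintegral_const_mul _ (by fun_prop),
      lintegral_sub_right_eq_self (fun x => ENNReal.ofReal (Real.exp (-Q x / 2)))]
  have hN : ∫⁻ x in {x | η ≤ ‖x - m‖}, L x ∂(μ.withDensity g) ≤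
      b * ∫⁻ x, L x ∂(μ.withDensity g) := by
    rw [setLIntegral_withDensity_eq_setLIntegral_mul _ hg hL hA, hZ]
    simp only [Pi.mul_apply, hK]
    calc _ ≤ ∫⁻ x in {x | η ≤ ‖x - m‖}, K * (ENNReal.ofReal (Real.exp (-(c * η ^ 2 / 4))) *
            ENNReal.ofReal (Real.exp (-Q (x - m) / 4))) ∂μ := by
          refine setLIntegral_mono (by fun_prop) fun x hx => ?_
          gcongr
          rw [← ENNReal.ofReal_mul (Real.exp_pos _).le, ← Real.exp_add]
          refine ENNReal.ofReal_le_ofReal (Real.exp_le_exp.2 ?_)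
          have h1 := hc (x - m)
          have h2 : c * η ^ 2 ≤ c * ‖x - m‖ ^ 2 := by
            have : η ≤ ‖x - m‖ := hx
            gcongr
          linarith
      _ ≤ ∫⁻ x, K * (ENNReal.ofReal (Real.exp (-(c * η ^ 2 / 4))) *
            ENNReal.ofReal (Real.exp (-Q (x - m) / 4))) ∂μ := setLIntegral_le_lintegral _ _
      _ = _ := by
          rw [lintegral_const_mul _ (by fun_prop), lintegral_const_mul _ (by fun_prop),
            lintegral_sub_right_eq_self (fun x => ENNReal.ofReal (Real.exp (-Q x / 4))),
            lintegral_exp_neg_quarter μ hQ hom, hb, ENNReal.ofReal_mul (by positivity)]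
          ring
  rw [bayesPosterior, Measure.smul_apply, withDensity_apply _ hA, smul_eq_mul]
  calc _ ≤ (∫⁻ x, L x ∂(μ.withDensity g))⁻¹ * (b * ∫⁻ x, L x ∂(μ.withDensity g)) := by gcongr
    _ = b * ((∫⁻ x, L x ∂(μ.withDensity g))⁻¹ * ∫⁻ x, L x ∂(μ.withDensity g)) := by ring
    -- The inequality holds even for a zero or infinite normaliser, so neither case needs exclusion.
    _ ≤ b * 1 := by gcongr; exact ENNReal.inv_mul_le_one _
    _ = b := mul_one b

end GaussianConcentration

/-! ### Consequences of the eigenvalue bounds -/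

theorem Matrix.IsHermitian.mul_norm_sq_le_dotProduct {p : ℕ} {A : Matrix (Fin p) (Fin p) ℝ}
    (hA : A.IsHermitian) {c : ℝ} (hc : ∀ j, c ≤ hA.eigenvalues j) (u : EuclideanSpace ℝ (Fin p)) :
    c * ‖u‖ ^ 2 ≤ u.ofLp ⬝ᵥ A *ᵥ u.ofLp := by
  set b := hA.eigenvectorBasis
  have hb : ∀ j, inner ℝ (b j) (WithLp.toLp 2 (A *ᵥ u.ofLp)) =
      hA.eigenvalues j * inner ℝ (b j) u := by
    intro j
    have hAt : Aᵀ = A := by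
      rw [← Matrix.conjTranspose_eq_transpose_of_trivial]; exact hA
    simp only [EuclideanSpace.inner_eq_star_dotProduct, star_trivial]
    rw [dotProduct_comm, Matrix.dotProduct_mulVec, ← Matrix.mulVec_transpose, hAt,
      hA.mulVec_eigenvectorBasis j, smul_dotProduct, smul_eq_mul, dotProduct_comm]
  have h1 : u.ofLp ⬝ᵥ A *ᵥ u.ofLp = ∑ j, hA.eigenvalues j * (inner ℝ (b j) u) ^ 2 := by
    have : u.ofLp ⬝ᵥ A *ᵥ u.ofLp = inner ℝ u (WithLp.toLp 2 (A *ᵥ u.ofLp)) := by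
      simp only [EuclideanSpace.inner_eq_star_dotProduct, star_trivial, dotProduct_comm]
    rw [this, ← b.sum_inner_mul_inner]
    refine Finset.sum_congr rfl fun j _ => ?_
    rw [hb, real_inner_comm]
    ring
  rw [h1, ← b.sum_sq_inner_right u, Finset.mul_sum]
  exact Finset.sum_le_sum fun j _ => mul_le_mul_of_nonneg_right (hc j) (sq_nonneg _)

theorem mul_norm_sq_le_of_lt_minEigenvalue {n p : ℕ} {X : Matrix (Fin n) (Fin p) ℝ} {c : ℝ}
    (hc : (c : EReal) < minEigenvalue X) (u : EuclideanSpace ℝ (Fin p)) :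
    n * c * ‖u‖ ^ 2 ≤ ∑ i, (X *ᵥ u.ofLp) i ^ 2 := by
  have h := (scaledGram_isHermitian X).mul_norm_sq_le_dotProduct (c := c)
    (fun j => EReal.coe_le_coe_iff.1 (hc.le.trans (iInf_le _ j))) u
  have h2 : u.ofLp ⬝ᵥ scaledGram X *ᵥ u.ofLp = (n : ℝ)⁻¹ * ∑ i, (X *ᵥ u.ofLp) i ^ 2 := by
    rw [scaledGram, Matrix.smul_mulVec, dotProduct_smul, ← Matrix.mulVec_mulVec,
      Matrix.dotProduct_mulVec, Matrix.vecMul_transpose, smul_eq_mul]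
    simp [dotProduct, pow_two]
  rw [h2] at h
  rcases Nat.eq_zero_or_pos n with rfl | hn
  · simp
  have hn' : (0 : ℝ) < n := by exact_mod_cast hn
  calc n * c * ‖u‖ ^ 2 = n * (c * ‖u‖ ^ 2) := by ring
    _ ≤ n * ((n : ℝ)⁻¹ * ∑ i, (X *ᵥ u.ofLp) i ^ 2) := by gcongr
    _ = _ := by field_simp

/-- The trace of `XᵀX / n` is both the scaled squared Frobenius norm and the sum of `p` eigenvalues.
-/
theorem sum_sq_le_of_maxEigenvalue_lt {n p : ℕ} {X : Matrix (Fin n) (Fin p) ℝ} {c : ℝ}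
    (hc : maxEigenvalue X < (c : EReal)) :
    ∑ j, ∑ i, X i j ^ 2 ≤ n * (p * c) := by
  have h := (scaledGram_isHermitian X).trace_eq_sum_eigenvalues
  have h1 : (scaledGram X).trace = (n : ℝ)⁻¹ * ∑ j, ∑ i, X i j ^ 2 := by
    simp [scaledGram, Matrix.trace, Matrix.mul_apply, pow_two, Finset.mul_sum]
  have h2 : (scaledGram X).trace ≤ p * c := by
    rw [h]
    calc _ ≤ ∑ _j : Fin p, c := Finset.sum_le_sum fun j _ => EReal.coe_le_coe_iff.1
          ((le_iSup (fun j => (((scaledGram_isHermitian X).eigenvalues j : ℝ) : EReal)) j).trans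
            hc.le)
      _ = p * c := by simp
  rw [h1] at h2
  rcases Nat.eq_zero_or_pos n with rfl | hn
  · simp
  have hn' : (0 : ℝ) < n := by exact_mod_cast hn
  rwa [inv_mul_le_iff₀ hn'] at h2

/-! ### The ridge estimator -/

/-- The ridge regression normal equations are solvable. -/
theorem exists_ridge_solution {n p : ℕ} (X : Matrix (Fin n) (Fin p) ℝ) (y : Fin n → ℝ) {γ : ℝ}
    (hγ : 0 < γ) : ∃ m : Fin p → ℝ, Xᵀ *ᵥ (y - X *ᵥ m) = γ • m := by
  let T : (Fin p → ℝ) →ₗ[ℝ] (Fin p → ℝ) := (Xᵀ * X).mulVecLin + γ • LinearMap.id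
  have hT : ∀ u, T u = Xᵀ *ᵥ (X *ᵥ u) + γ • u := fun u => by
    simp only [T, LinearMap.add_apply, Matrix.mulVecLin_apply, Matrix.mulVec_mulVec,
      LinearMap.smul_apply, LinearMap.id_apply]
  -- `u ⬝ᵥ T u = |X u| ^ 2 + γ |u| ^ 2` forces a trivial kernel; in finite dimension injectivity
  -- gives surjectivity.
  have hinj : Function.Injective T := by
    rw [← LinearMap.ker_eq_bot, LinearMap.ker_eq_bot']
    intro u hu
    have h0 : u ⬝ᵥ T u = 0 := by rw [hu, dotProduct_zero]
    rw [hT, dotProduct_add, Matrix.dotProduct_mulVec, Matrix.vecMul_transpose, dotProduct_smul,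
      smul_eq_mul] at h0
    have h1 : 0 ≤ X *ᵥ u ⬝ᵥ X *ᵥ u := Finset.sum_nonneg fun i _ => mul_self_nonneg _
    have h2 : 0 ≤ u ⬝ᵥ u := Finset.sum_nonneg fun i _ => mul_self_nonneg _
    exact dotProduct_self_eq_zero.1 (by nlinarith)
  obtain ⟨m, hm⟩ := LinearMap.injective_iff_surjective.1 hinj (Xᵀ *ᵥ y)
  refine ⟨m, ?_⟩
  rw [Matrix.mulVec_sub, ← hm, hT]
  simp

/-- Completing the square around the ridge estimator. -/
theorem ridge_complete_square {n p : ℕ} {X : Matrix (Fin n) (Fin p) ℝ} {y : Fin n → ℝ} {γ : ℝ}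
    {m : Fin p → ℝ} (hm : Xᵀ *ᵥ (y - X *ᵥ m) = γ • m) (b : Fin p → ℝ) :
    ∑ i, (y i - (X *ᵥ b) i) ^ 2 + γ * ∑ j, b j ^ 2 =
      (∑ i, (X *ᵥ (b - m)) i ^ 2 + γ * ∑ j, (b - m) j ^ 2) +
        (∑ i, (y i - (X *ᵥ m) i) ^ 2 + γ * ∑ j, m j ^ 2) := by
  -- The normal equations make the cross terms of the two squares cancel.
  have hcross : (y - X *ᵥ m) ⬝ᵥ X *ᵥ (b - m) = γ * (m ⬝ᵥ (b - m)) := by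
    rw [Matrix.dotProduct_mulVec, ← Matrix.mulVec_transpose, hm, smul_dotProduct, smul_eq_mul]
  have h1 : ∑ i, (y i - (X *ᵥ b) i) ^ 2 = ∑ i, (y i - (X *ᵥ m) i) ^ 2 +
      ∑ i, (X *ᵥ (b - m)) i ^ 2 - 2 * ((y - X *ᵥ m) ⬝ᵥ X *ᵥ (b - m)) := by
    rw [dotProduct, Finset.mul_sum, ← Finset.sum_add_distrib, ← Finset.sum_sub_distrib]
    refine Finset.sum_congr rfl fun i _ => ?_
    simp only [Matrix.mulVec_sub, Pi.sub_apply]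
    ring
  have h2 : ∑ j, b j ^ 2 = ∑ j, m j ^ 2 + ∑ j, (b - m) j ^ 2 + 2 * (m ⬝ᵥ (b - m)) := by
    rw [dotProduct, Finset.mul_sum, ← Finset.sum_add_distrib, ← Finset.sum_add_distrib]
    refine Finset.sum_congr rfl fun i _ => ?_
    simp only [Pi.sub_apply]
    ring
  rw [h1, h2, hcross]
  ring

/-- Estimation error of the ridge estimator: a noise term plus a shrinkage bias. -/
theorem ridge_error_le {n p : ℕ} {X : Matrix (Fin n) (Fin p) ℝ} {e : Fin n → ℝ} {γ a : ℝ}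
    (hγ : 0 < γ) (ha : 0 < a)
    (hX : ∀ u : EuclideanSpace ℝ (Fin p), a * ‖u‖ ^ 2 ≤ ∑ i, (X *ᵥ u.ofLp) i ^ 2)
    {β m : EuclideanSpace ℝ (Fin p)}
    (hm : Xᵀ *ᵥ (response X β e - X *ᵥ m.ofLp) = γ • m.ofLp) :
    ‖m - β‖ ≤ ‖WithLp.toLp 2 (Xᵀ *ᵥ e)‖ / a + √(γ * ‖β‖ ^ 2 / a) := by
  set d := m - β with hd
  have hmd : m.ofLp = β.ofLp + d.ofLp := by simp [hd]
  -- Energy identity: pair the normal equations with the error `d`.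
  have h1 : ∑ i, (X *ᵥ d.ofLp) i ^ 2 + γ * ‖d‖ ^ 2 =
      inner ℝ d (WithLp.toLp 2 (Xᵀ *ᵥ e)) - γ * inner ℝ d β := by
    have h := congrArg (fun z => d.ofLp ⬝ᵥ z) hm
    have hr : response X β e - X *ᵥ m.ofLp = e - X *ᵥ d.ofLp := by
      rw [hmd, Matrix.mulVec_add, response]; abel
    simp only [hr] at h
    rw [Matrix.mulVec_sub, dotProduct_sub, hmd, dotProduct_smul, dotProduct_add,
      Matrix.dotProduct_mulVec _ _ (X *ᵥ d.ofLp), Matrix.vecMul_transpose, smul_eq_mul] at h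
    have e1 : inner ℝ d (WithLp.toLp 2 (Xᵀ *ᵥ e)) = d.ofLp ⬝ᵥ Xᵀ *ᵥ e := by
      simp only [EuclideanSpace.inner_eq_star_dotProduct, star_trivial, dotProduct_comm]
    have e2 : inner ℝ d β = d.ofLp ⬝ᵥ β.ofLp := by
      simp only [EuclideanSpace.inner_eq_star_dotProduct, star_trivial, dotProduct_comm]
    have e3 : ‖d‖ ^ 2 = d.ofLp ⬝ᵥ d.ofLp := by
      rw [← real_inner_self_eq_norm_sq]
      simp only [EuclideanSpace.inner_eq_star_dotProduct, star_trivial]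
    have e4 : ∑ i, (X *ᵥ d.ofLp) i ^ 2 = X *ᵥ d.ofLp ⬝ᵥ X *ᵥ d.ofLp := by
      simp [dotProduct, pow_two]
    rw [e1, e2, e3, e4]
    linarith
  set N := ‖WithLp.toLp 2 (Xᵀ *ᵥ e)‖
  have hN : 0 ≤ N := norm_nonneg _
  have h2 : inner ℝ d (WithLp.toLp 2 (Xᵀ *ᵥ e)) ≤ ‖d‖ * N := real_inner_le_norm _ _
  have h3 : -inner ℝ d β ≤ ‖d‖ * ‖β‖ := (neg_le_abs _).trans (abs_real_inner_le_norm _ _)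
  have h4 : (a + γ) * ‖d‖ ≤ N + γ * ‖β‖ := by
    rcases (norm_nonneg d).eq_or_lt with h0 | h0
    · rw [← h0, mul_zero]; positivity
    · have := hX d
      have h5 := mul_le_mul_of_nonneg_left h3 hγ.le
      refine le_of_mul_le_mul_left (?_ : ‖d‖ * _ ≤ ‖d‖ * _) h0
      nlinarith
  have h5 : ‖d‖ ≤ N / (a + γ) + γ * ‖β‖ / (a + γ) := by
    rw [← add_div, le_div_iff₀ (by positivity)]; linarith
  have h6 : N / (a + γ) ≤ N / a := by gcongr; linarith
  -- Uses `γ * a ≤ (a + γ) ^ 2`. This form needs only `γ ‖β‖ ^ 2 / a → 0`, which also covers `β = 0`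
  -- with `γ / a` large.
  have h7 : γ * ‖β‖ / (a + γ) ≤ √(γ * ‖β‖ ^ 2 / a) := by
    refine Real.le_sqrt_of_sq_le ?_
    rw [div_pow, div_le_div_iff₀ (by positivity) ha]
    have : 0 ≤ γ * ‖β‖ ^ 2 * (a ^ 2 + a * γ + γ ^ 2) := by positivity
    nlinarith
  linarith

theorem norm_sq_le_numNonzero_mul {p : ℕ} (β : EuclideanSpace ℝ (Fin p)) {M : ℝ}
    (hM : ∀ j, |β j| ≤ M) : ‖β‖ ^ 2 ≤ numNonzero β * M ^ 2 := by
  classical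
  rw [EuclideanSpace.norm_sq_eq, numNonzero,
    show {j | β j ≠ 0} = ((Finset.univ.filter fun j => β j ≠ 0 : Finset (Fin p)) : Set (Fin p)) by
      simp, Set.ncard_coe_finset, ← nsmul_eq_mul, ← Finset.sum_const, Finset.sum_filter]
  refine Finset.sum_le_sum fun j _ => ?_
  split_ifs with h
  · rw [Real.norm_eq_abs]
    exact pow_le_pow_left₀ (abs_nonneg _) (hM j) 2
  · simp [not_not.1 h]

theorem measurable_gaussianLikelihood {n p : ℕ} (X : Matrix (Fin n) (Fin p) ℝ) (v : ℝ≥0)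
    (y : Fin n → ℝ) : Measurable (gaussianLikelihood X v y) := by
  unfold gaussianLikelihood gaussianPDF gaussianPDFReal Matrix.mulVec dotProduct
  fun_prop

/-- Concentration of the normal posterior around the ridge estimator. -/
theorem normalPosterior_le {n p : ℕ} {X : Matrix (Fin n) (Fin p) ℝ} {v w : ℝ≥0} (hv : v ≠ 0)
    (hw : w ≠ 0) {y : Fin n → ℝ} {a : ℝ} (ha : 0 ≤ a)
    (hX : ∀ u : EuclideanSpace ℝ (Fin p), a * ‖u‖ ^ 2 ≤ ∑ i, (X *ᵥ u.ofLp) i ^ 2)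
    {m : EuclideanSpace ℝ (Fin p)}
    (hm : Xᵀ *ᵥ (y - X *ᵥ m.ofLp) = ((v : ℝ) / w) • m.ofLp) {η : ℝ} (hη : 0 ≤ η) :
    normalPosterior X v w y {β | η ≤ ‖β - m‖} ≤
      ENNReal.ofReal (√2 ^ p * Real.exp (-(a / v * η ^ 2 / 4))) := by
  have hv' : (0 : ℝ) < v := by exact_mod_cast hv.bot_lt
  have hw' : (0 : ℝ) < w := by exact_mod_cast hw.bot_lt
  let Q : EuclideanSpace ℝ (Fin p) → ℝ := fun u =>
    (∑ i, (X *ᵥ u.ofLp) i ^ 2 + (v : ℝ) / w * ∑ j, u.ofLp j ^ 2) / v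
  have hQm : Measurable Q := by
    unfold Q Matrix.mulVec dotProduct
    fun_prop
  have hom : ∀ (t : ℝ) u, Q (t • u) = t ^ 2 * Q u := by
    intro t u
    simp only [Q, WithLp.ofLp_smul, Matrix.mulVec_smul, Pi.smul_apply, smul_eq_mul, mul_pow,
      ← Finset.mul_sum]
    ring
  have hc : ∀ u, a / v * ‖u‖ ^ 2 ≤ Q u := by
    intro u
    have h0 : 0 ≤ (v : ℝ) / w * ∑ j, u.ofLp j ^ 2 := by positivity
    rw [div_mul_eq_mul_div]
    exact div_le_div_of_nonneg_right (by linarith [hX u]) hv'.le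
  set R := ∑ i, (y i - (X *ᵥ m.ofLp) i) ^ 2 + (v : ℝ) / w * ∑ j, m.ofLp j ^ 2 with hR
  set kp := (√(2 * Real.pi * w))⁻¹ ^ p
  set kl := (√(2 * Real.pi * v))⁻¹ ^ n
  have hK : ∀ β, (∏ j, gaussianPDF 0 w (β j)) * gaussianLikelihood X v y β =
      ENNReal.ofReal (kp * kl * Real.exp (-R / (2 * v))) *
        ENNReal.ofReal (Real.exp (-Q (β - m) / 2)) := by
    intro β
    rw [gaussianLikelihood, prod_gaussianPDF_eq (fun _ => 0), prod_gaussianPDF_eq,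
      ← ENNReal.ofReal_mul (by positivity), ← ENNReal.ofReal_mul (by positivity)]
    congr 1
    have hs := ridge_complete_square hm β.ofLp
    rw [mul_mul_mul_comm, ← Real.exp_add, mul_assoc (kp * kl), ← Real.exp_add]
    congr 2
    simp only [sub_zero, Q, WithLp.ofLp_sub]
    rw [← hR] at hs
    have hs' : ∑ i, (X *ᵥ (β.ofLp - m.ofLp)) i ^ 2 +
        (v : ℝ) / w * ∑ j, (β.ofLp - m.ofLp) j ^ 2 =
        ∑ i, (y i - (X *ᵥ β.ofLp) i) ^ 2 + (v : ℝ) / w * ∑ j, β.ofLp j ^ 2 - R := by linarith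
    rw [hs']
    field_simp
    ring
  have hg : Measurable fun β : EuclideanSpace ℝ (Fin p) => ∏ j, gaussianPDF 0 w (β j) :=
    Finset.measurable_prod _ fun j _ => (measurable_gaussianPDF 0 w).comp (by fun_prop)
  have h := bayesPosterior_withDensity_le volume hg (measurable_gaussianLikelihood X v y) hQm hom hc
    (by positivity) m hK hη
  rwa [← normalPrior_eq_withDensity p hw, finrank_euclideanSpace_fin] at h

/-! ### Second moment of the noise term -/

section Noise

variable {Ω : Type*} [MeasurableSpace Ω] {μ : Measure Ω} {n p : ℕ}
  (X : Matrix (Fin n) (Fin p) ℝ) {ε : Fin n → Ω → ℝ}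

theorem memLp_mulVec_noise (hL2 : ∀ i, MemLp (ε i) 2 μ) (j : Fin p) :
    MemLp (fun ω => (Xᵀ *ᵥ fun i => ε i ω) j) 2 μ :=
  memLp_finsetSum Finset.univ fun i _ => (hL2 i).const_mul (X i j)

variable [IsProbabilityMeasure μ]

theorem integral_norm_sq_noise {s : ℝ} (hindep : iIndepFun ε μ) (hL2 : ∀ i, MemLp (ε i) 2 μ)
    (hmean : ∀ i, ∫ ω, ε i ω ∂μ = 0) (hvar : ∀ i, variance (ε i) μ = s) :
    ∫ ω, ‖WithLp.toLp 2 (Xᵀ *ᵥ fun i => ε i ω)‖ ^ 2 ∂μ = s * ∑ j, ∑ i, X i j ^ 2 := by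
  simp only [EuclideanSpace.norm_sq_eq, Real.norm_eq_abs, sq_abs]
  rw [integral_finsetSum _ fun j _ => (memLp_mulVec_noise X hL2 j).integrable_sq, Finset.mul_sum]
  refine Finset.sum_congr rfl fun j _ => ?_
  have hm : ∫ ω, (Xᵀ *ᵥ fun i => ε i ω) j ∂μ = 0 := by
    simp only [Matrix.mulVec, dotProduct, Matrix.transpose_apply]
    rw [integral_finsetSum _ fun i _ => ((hL2 i).integrable (by norm_num)).const_mul _]
    simp [integral_const_mul, hmean]
  rw [← variance_of_integral_eq_zero (memLp_mulVec_noise X hL2 j).aemeasurable hm]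
  have hsum : (fun ω => (Xᵀ *ᵥ fun i => ε i ω) j) = ∑ i, fun ω => X i j * ε i ω := by
    ext ω
    simp [Matrix.mulVec, dotProduct]
  rw [hsum, IndepFun.variance_sum (fun i _ => (hL2 i).const_mul _), Finset.mul_sum]
  · refine Finset.sum_congr rfl fun i _ => ?_
    rw [variance_const_mul, hvar, mul_comm]
  · intro i _ k _ hik
    exact (hindep.indepFun hik).comp (measurable_const_mul (X i j)) (measurable_const_mul (X k j))

theorem measureReal_le_norm_noise {s : ℝ} (hindep : iIndepFun ε μ) (hL2 : ∀ i, MemLp (ε i) 2 μ)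
    (hmean : ∀ i, ∫ ω, ε i ω ∂μ = 0) (hvar : ∀ i, variance (ε i) μ = s) {T : ℝ} (hT : 0 < T) :
    μ.real {ω | T ≤ ‖WithLp.toLp 2 (Xᵀ *ᵥ fun i => ε i ω)‖} ≤
      s * (∑ j, ∑ i, X i j ^ 2) / T ^ 2 := by
  have hint : Integrable (fun ω => ‖WithLp.toLp 2 (Xᵀ *ᵥ fun i => ε i ω)‖ ^ 2) μ := by
    simp only [EuclideanSpace.norm_sq_eq, Real.norm_eq_abs, sq_abs]
    exact integrable_finsetSum _ fun j _ => (memLp_mulVec_noise X hL2 j).integrable_sq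
  have h := mul_meas_ge_le_integral_of_nonneg (ae_of_all _ fun ω => sq_nonneg _) hint (T ^ 2)
  rw [integral_norm_sq_noise X hindep hL2 hmean hvar] at h
  rw [le_div_iff₀ (by positivity), mul_comm]
  refine le_trans (mul_le_mul_of_nonneg_left (measureReal_mono fun ω hω => ?_) (by positivity)) h
  exact pow_le_pow_left₀ hT.le hω 2

end Noise

/-- Probability that the normal posterior puts mass at least `δ` away from the true parameter. -/
theorem measureReal_le_normalPosterior {Ω : Type*} [MeasurableSpace Ω] {μ : Measure Ω}
    [IsProbabilityMeasure μ] {n p : ℕ} {X : Matrix (Fin n) (Fin p) ℝ} {ε : Fin n → Ω → ℝ}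
    {v w : ℝ≥0} (hv : v ≠ 0) (hw : w ≠ 0) (hindep : iIndepFun ε μ) (hL2 : ∀ i, MemLp (ε i) 2 μ)
    (hmean : ∀ i, ∫ ω, ε i ω ∂μ = 0) (hvar : ∀ i, variance (ε i) μ = v) {a : ℝ} (ha : 0 < a)
    (hX : ∀ u : EuclideanSpace ℝ (Fin p), a * ‖u‖ ^ 2 ≤ ∑ i, (X *ᵥ u.ofLp) i ^ 2)
    (β₀ : EuclideanSpace ℝ (Fin p)) {η δ : ℝ} (hη : 0 < η)
    (hbias : √((v : ℝ) / w * ‖β₀‖ ^ 2 / a) ≤ η / 4)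
    (hδ : √2 ^ p * Real.exp (-(a / v * (η / 2) ^ 2 / 4)) < δ) :
    μ.real {ω | δ ≤ (normalPosterior X v w (response X β₀ fun i => ε i ω)).real
        {β | η < ‖β - β₀‖}} ≤
      v * (∑ j, ∑ i, X i j ^ 2) / (a * (η / 4)) ^ 2 := by
  have hv' : (0 : ℝ) < v := by exact_mod_cast hv.bot_lt
  have hw' : (0 : ℝ) < w := by exact_mod_cast hw.bot_lt
  refine (measureReal_mono fun ω hω => ?_).trans
    (measureReal_le_norm_noise X hindep hL2 hmean hvar (by positivity))
  rw [Set.mem_ofPred_eq] at hω ⊢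
  -- On the event of small noise the bound is deterministic: `η / 4` for noise and `η / 4` for bias
  -- leave posterior radius `η / 2` around `m`.
  by_contra! hlt
  set y := response X β₀ fun i => ε i ω
  obtain ⟨m', hm'⟩ := exists_ridge_solution X y (γ := (v : ℝ) / w) (by positivity)
  set m : EuclideanSpace ℝ (Fin p) := WithLp.toLp 2 m'
  have herr := ridge_error_le (β := β₀) (m := m) (by positivity) ha hX hm'
  have h1 : ‖WithLp.toLp 2 (Xᵀ *ᵥ fun i => ε i ω)‖ / a < η / 4 := by
    rw [div_lt_iff₀ ha]; linarith
  have hpost := normalPosterior_le (m := m) hv hw ha.le hX hm' (half_pos hη).le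
  have hprob := normalPosterior_isProbabilityMeasure X hv w y
  have hsub : {β | η < ‖β - β₀‖} ⊆ {β | η / 2 ≤ ‖β - m‖} := by
    intro β hβ
    rw [Set.mem_ofPred_eq] at hβ ⊢
    have h2 := norm_sub_le_norm_sub_add_norm_sub β m β₀
    linarith
  have h3 : (normalPosterior X v w y).real {β | η < ‖β - β₀‖} ≤
      √2 ^ p * Real.exp (-(a / v * (η / 2) ^ 2 / 4)) :=
    (measureReal_mono hsub).trans (ENNReal.toReal_le_of_le_ofReal (by positivity) hpost)
  linarith

/-! ### Asymptotics and conclusion -/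

theorem tendsto_sqrt_two_pow_mul_exp {p : ℕ → ℕ}
    (hp : (fun n => (p n : ℝ)) =o[atTop] fun n => (n : ℝ)) {κ : ℝ} (hκ : 0 < κ) :
    Tendsto (fun n : ℕ => √2 ^ p n * Real.exp (-(n * κ))) atTop (𝓝 0) := by
  have h1 : Tendsto (fun n : ℕ => Real.exp (-(n * (κ / 2)))) atTop (𝓝 0) :=
    Real.tendsto_exp_neg_atTop_nhds_zero.comp
      (tendsto_natCast_atTop_atTop.atTop_mul_const (half_pos hκ))
  have hb := hp.bound (half_pos hκ)
  refine squeeze_zero' (Eventually.of_forall fun n => by positivity) ?_ h1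
  filter_upwards [hb] with n hn
  rw [Real.norm_natCast, Real.norm_natCast] at hn
  have h2 : √2 ≤ Real.exp 1 := by
    have : √2 ≤ 2 := Real.sqrt_le_iff.2 (by norm_num)
    linarith [Real.add_one_le_exp (1 : ℝ)]
  calc √2 ^ p n * Real.exp (-(n * κ)) ≤ Real.exp 1 ^ p n * Real.exp (-(n * κ)) := by gcongr
    _ = Real.exp (p n - n * κ) := by
        rw [← Real.exp_nat_mul, ← Real.exp_add]; congr 1; ring
    _ ≤ _ := Real.exp_le_exp.2 (by linarith)

theorem eventually_abs_coord_le {p : ℕ → ℕ} {β : (n : ℕ) → EuclideanSpace ℝ (Fin (p n))}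
    (hβ : limsup (fun n => ⨆ j, ((|β n j| : ℝ) : EReal)) atTop < ⊤) :
    ∃ M : ℝ, ∀ᶠ n in atTop, ∀ j, |β n j| ≤ M := by
  obtain ⟨M, hM, -⟩ := EReal.lt_iff_exists_real_btwn.1 hβ
  refine ⟨M, (eventually_lt_of_limsup_lt hM).mono fun n hn j => ?_⟩
  exact EReal.coe_le_coe_iff.1
    ((le_iSup (fun j => ((|β n j| : ℝ) : EReal)) j).trans hn.le)

theorem theorem1
    {Ω : Type*} [MeasurableSpace Ω] (μ : Measure Ω) [IsProbabilityMeasure μ]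
    -- dimensions, designs, true coefficients, errors (a triangular array), prior precisions
    (p : ℕ → ℕ) (hp : ∀ n, 0 < p n)
    (X : (n : ℕ) → Matrix (Fin n) (Fin (p n)) ℝ)
    (β₀ : (n : ℕ) → EuclideanSpace ℝ (Fin (p n)))
    (ε : (n : ℕ) → Fin n → Ω → ℝ)
    (σ : ℝ) (hσ : 0 < σ) (γ : ℕ → ℝ)
    -- (A1) for each n the errors are i.i.d. with mean zero and variance σ²
    (hindep : ∀ n, iIndepFun (ε n) μ)
    (hident : ∀ n i j, IdentDistrib (ε n i) (ε n j) μ μ)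
    (hL2 : ∀ n i, MemLp (ε n i) 2 μ)
    (hmean : ∀ n i, ∫ ω, ε n i ω ∂μ = 0)
    (hvar : ∀ n i, variance (ε n i) μ = σ ^ 2)
    -- (A2) the eigenvalues of XᵀX / n are bounded away from 0 and ∞
    (dmin dmax : ℝ) (hdmin : 0 < dmin)
    (hlow : (dmin : EReal) < liminf (fun n => minEigenvalue (X n)) atTop)
    (hupp : limsup (fun n => maxEigenvalue (X n)) atTop < (dmax : EReal))
    -- (A3) the true coefficients are bounded
    (hβ : limsup (fun n => ⨆ j, ((|β₀ n j| : ℝ) : EReal)) atTop < ⊤)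
    -- growth of the dimension and of the number of nonzero true coefficients
    (hpn : (fun n => (p n : ℝ)) =o[atTop] fun n => (n : ℝ))
    (ρ : ℝ) (hρ : ρ ∈ Set.Ioo (0 : ℝ) 1)
    (hqn : (fun n => (numNonzero (β₀ n) : ℝ)) =o[atTop]
      fun n => (n : ℝ) ^ (1 - ρ) / ((p n : ℝ) * Real.log n ^ 2))
    -- the prior scale
    (C : ℝ) (hC : 0 < C)
    (hγ : ∀ᶠ n : ℕ in atTop,
      √(σ ^ 2 / γ n) = C / (√(p n : ℝ) * (n : ℝ) ^ (ρ / 2) * Real.log n)) :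
    PosteriorConsistent μ
      (fun n ω => normalPosterior (X n) (σ ^ 2).toNNReal (σ ^ 2 / γ n).toNNReal
        (response (X n) (β₀ n) fun i => ε n i ω))
      β₀ := by
  intro η hη
  rw [tendstoInMeasure_iff_measureReal_norm]
  intro δ hδ
  obtain ⟨M, hM⟩ := eventually_abs_coord_le hβ
  have hpost : ∀ᶠ n : ℕ in atTop, √2 ^ p n * Real.exp (-(n * (dmin / σ ^ 2 * (η / 2) ^ 2 / 4))) < δ :=
    (tendsto_sqrt_two_pow_mul_exp hpn (by positivity)).eventually_lt_const hδ
  have hbias : ∀ᶠ n : ℕ in atTop, √(σ ^ 2 * M ^ 2 / (C ^ 2 * dmin) *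
      (numNonzero (β₀ n) / ((n : ℝ) ^ (1 - ρ) / ((p n : ℝ) * Real.log n ^ 2)))) < η / 4 := by
    have h := (hqn.tendsto_div_nhds_zero.const_mul (σ ^ 2 * M ^ 2 / (C ^ 2 * dmin))).sqrt
    rw [mul_zero, Real.sqrt_zero] at h
    exact h.eventually_lt_const (by positivity)
  have hlim : Tendsto (fun n : ℕ => σ ^ 2 * dmax / (dmin * (η / 4)) ^ 2 * ((p n : ℝ) / n)) atTop
      (𝓝 0) := by
    simpa using hpn.tendsto_div_nhds_zero.const_mul (σ ^ 2 * dmax / (dmin * (η / 4)) ^ 2)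
  refine squeeze_zero' (Eventually.of_forall fun n => measureReal_nonneg) ?_ hlim
  filter_upwards [hpost, hbias, hM, hγ, eventually_lt_of_lt_liminf hlow,
    eventually_lt_of_limsup_lt hupp, eventually_ge_atTop 2] with n hpost hbias hM hγ hlow hupp hn
  have hn0 : (0 : ℝ) < n := by positivity
  have hp0 : (0 : ℝ) < p n := by exact_mod_cast hp n
  have hlog : 0 < Real.log n := Real.log_pos (by exact_mod_cast hn)
  have hWpos : 0 < C / (√(p n : ℝ) * (n : ℝ) ^ (ρ / 2) * Real.log n) := by positivity
  -- A positive square root excludes the default values of division, `√` and `toNNReal`; `n ≥ 2`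
  -- ensures `log n > 0`.
  have hw0 : 0 < σ ^ 2 / γ n := Real.sqrt_pos.1 (hγ ▸ hWpos)
  have hw : σ ^ 2 / γ n = C ^ 2 / (p n * (n : ℝ) ^ ρ * Real.log n ^ 2) := by
    rw [← Real.sq_sqrt hw0.le, hγ, div_pow, mul_pow, mul_pow, Real.sq_sqrt hp0.le,
      ← Real.rpow_natCast ((n : ℝ) ^ (ρ / 2)) 2, ← Real.rpow_mul hn0.le]
    norm_num
  have hvc : ((σ ^ 2).toNNReal : ℝ) = σ ^ 2 := Real.coe_toNNReal _ (sq_nonneg σ)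
  have hwc : ((σ ^ 2 / γ n).toNNReal : ℝ) = σ ^ 2 / γ n := Real.coe_toNNReal _ hw0.le
  have key := measureReal_le_normalPosterior (v := (σ ^ 2).toNNReal)
    (w := (σ ^ 2 / γ n).toNNReal) (Real.toNNReal_pos.2 (by positivity)).ne'
    (Real.toNNReal_pos.2 hw0).ne' (hindep n) (hL2 n) (hmean n) (fun i => (hvar n i).trans hvc.symm)
    (mul_pos hn0 hdmin) (mul_norm_sq_le_of_lt_minEigenvalue hlow) (β₀ n) hη (δ := δ) ?_ ?_
  · simp only [sub_zero, Real.norm_eq_abs, abs_of_nonneg measureReal_nonneg]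
    refine key.trans ?_
    rw [hvc]
    calc _ ≤ σ ^ 2 * (n * (p n * dmax)) / (n * dmin * (η / 4)) ^ 2 := by
          gcongr
          exact sum_sq_le_of_maxEigenvalue_lt hupp
      _ = _ := by field_simp
  · refine le_trans (Real.sqrt_le_sqrt ?_) hbias.le
    rw [hvc, hwc, hw]
    calc _ ≤ σ ^ 2 / (C ^ 2 / (p n * (n : ℝ) ^ ρ * Real.log n ^ 2)) *
          (numNonzero (β₀ n) * M ^ 2) / (n * dmin) := by
          gcongr
          exact norm_sq_le_numNonzero_mul _ hM
      -- Since `n ^ ρ / n = 1 / n ^ (1 - ρ)`, this is exactly the ratio in `hqn`.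
      _ = _ := by
          rw [Real.rpow_sub hn0, Real.rpow_one]
          field_simp
  · convert hpost using 4
    rw [hvc]
    ring
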